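/- Let $G$ be a Polish, locally compact abelian topological group with its Borel $\sigma$-algebra, let $\lambda$ be a Haar measure on $G$ (with any fixed normalization), and equip $G\times G$ with $\lambda\times\lambda$. If a random variable $X$ with values in $G$ (or in $G\times G$) has a density $f$ with respect to $\lambda$ (respectively $\lambda\times\lambda$), its entropy is $h(X)=-\int f\log f$, whenever this integral exists; we say that $h(X)$ is finite if $X$ has a density and $f\log f$ is integrable. Write $h(Y\mid X)=h(X,Y)-h(X)$ and $I(Z;W)=h(Z)+h(W)-h(Z,W)$. The Ruzsa divergence is $$d_R(X\|Y)=h(X'-Y')-h(X'),$$ where $X'$ and $Y'$ are independent and distributed as $X$ and $Y$, and, when $X\leftrightarrow Z\leftrightarrow Y$ is a Markov chain, the conditional Ruzsa divergence is $$d_R(X\|Y\mid Z)=h(X-Y\mid Z)-h(X\mid Z).$$ Let $X_1,X_2,X_3$ be independent $G$-valued random variables on a common probability space such that $h(X_1)$, $h(X_2)$, $h(X_3)$, $h(X_1-X_3)$ and $h(X_2-X_3)$ are finite. 1. If $h(X_1-X_2,\,X_2-X_3)$ is finite, then $$d_R(X_1\|X_3)\le d_R(X_1\|X_2\mid X_2-X_3)+d_R(X_2\|X_3).$$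 2. If $h(X_1-X_2)$ and $h(X_1-X_2,\,X_2-X_3)$ are finite, then the right-hand side in 1 equals $d_R(X_1\|X_2)+d_R(X_2\|X_3)-I(X_1-X_2;\,X_2-X_3)$; that is, the inequality in 1 can be written equivalently as $$d_R(X_1\|X_3)\le d_R(X_1\|X_2)+d_R(X_2\|X_3)-I(X_1-X_2;\,X_2-X_3).$$ 3. If $h(X_1-X_2)$ is finite, then $$d_R(X_1\|X_3)\le d_R(X_1\|X_2)+d_R(X_2\|X_3).$$ -/

import Mathlib

open MeasureTheory ProbabilityTheory

namespace Ruzsa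

noncomputable section

/-- The density (with respect to the reference measure `m`) of the random variable `X`
under the probability measure `P`. -/
def density {Ω E : Type*} [MeasurableSpace Ω] [MeasurableSpace E]
    (m : Measure E) (P : Measure Ω) (X : Ω → E) (x : E) : ℝ :=
  ((P.map X).rnDeriv m x).toReal

/-- `X` has a density `f` with respect to `m`, and the integral `∫ f log f dm` exists in the
Lebesgue sense and is finite: the entropy of `X` is well defined and finite. -/
structure HasFiniteEntropy {Ω E : Type*} [MeasurableSpace Ω] [MeasurableSpace E]
    (m : Measure E) (P : Measure Ω) (X : Ω → E) : Prop where
  absolutelyContinuous : P.map X ≪ m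
  integrable : Integrable (fun x => density m P X x * Real.log (density m P X x)) m

/-- The entropy `h(X) = - ∫ f log f dm`, where `f` is the density of `X`. It is meaningful
if `HasFiniteEntropy m P X`. -/
def entropy {Ω E : Type*} [MeasurableSpace Ω] [MeasurableSpace E]
    (m : Measure E) (P : Measure Ω) (X : Ω → E) : ℝ :=
  - ∫ x, density m P X x * Real.log (density m P X x) ∂m

/-- The conditional entropy `h(Y | X) = h(X, Y) - h(X)`; the entropy of the pair is taken with
respect to the product measure. -/
def condEntropy {Ω E F : Type*} [MeasurableSpace Ω] [MeasurableSpace E] [MeasurableSpace F]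
    (mE : Measure E) (mF : Measure F) (P : Measure Ω) (Y : Ω → E) (X : Ω → F) : ℝ :=
  entropy (mF.prod mE) P (fun ω => (X ω, Y ω)) - entropy mF P X

/-- The mutual information `I(Z; W) = h(Z) + h(W) - h(Z, W)`. -/
def mutualInfo {Ω E F : Type*} [MeasurableSpace Ω] [MeasurableSpace E] [MeasurableSpace F]
    (mE : Measure E) (mF : Measure F) (P : Measure Ω) (Z : Ω → E) (W : Ω → F) : ℝ :=
  entropy mE P Z + entropy mF P W - entropy (mE.prod mF) P (fun ω => (Z ω, W ω))

/-- The Ruzsa divergence `d_R(X ‖ Y) = h(X' - Y') - h(X')`, where `X'` and `Y'` are independent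
copies of `X` and `Y`: the coordinate functions on `G × G` under the product of the two laws. -/
def ruzsaDiv {Ω G : Type*} [MeasurableSpace Ω] [MeasurableSpace G] [AddCommGroup G]
    (m : Measure G) (P : Measure Ω) (X Y : Ω → G) : ℝ :=
  entropy m ((P.map X).prod (P.map Y)) (fun z : G × G => z.1 - z.2) -
    entropy m ((P.map X).prod (P.map Y)) (fun z : G × G => z.1)

/-- The conditional Ruzsa divergence `d_R(X ‖ Y | Z) = h(X - Y | Z) - h(X | Z)`, for `X`, `Z`, `Y`
forming a Markov chain in this order. -/
def condRuzsaDiv {Ω G : Type*} [MeasurableSpace Ω] [MeasurableSpace G] [AddCommGroup G]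
    (m : Measure G) (P : Measure Ω) (X Y Z : Ω → G) : ℝ :=
  condEntropy m m P (fun ω => X ω - Y ω) Z - condEntropy m m P X Z

end

end Ruzsa

namespace Ruzsa

open scoped ENNReal

/-! ### Entropy as an expected log-density; Gibbs' inequality -/

section General

variable {Ω E F : Type*} [MeasurableSpace Ω] [MeasurableSpace E] [MeasurableSpace F]
  {m : Measure E} {P : Measure Ω} {X : Ω → E}

/-! By independence `h(X₁, X₂ - X₃)` splits into a sum, so once every divergence is written through
entropies of the given variables, the identity in part 2 is algebra and the inequality in part 1
becomes `h(X₁ - X₃) + h(X₂) ≤ h(X₁ - X₂, X₂ - X₃)`.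

This is Gibbs' inequality. Let `k`, `f`, `g` be the densities of `(X₁ - X₂, X₂ - X₃)`, `X₁ - X₃` and
`X₂`. Since `X₂` is independent of `(X₁, X₃)`, integrating it out cancels `g`; translating by `X₃`
leaves a function of `X₁ - X₃` alone, whose law cancels `f`; the shear `(a, b) ↦ (a - b, b)`
preserves Haar measure. So `k / (f g)` has expectation at most 1
(`lintegral_exp_log_density_sub_sub_le_one`), and Jensen in the form `a ≤ exp a - 1` concludes.

Part 3 drops the mutual information, which is nonnegative. The joint entropy is not assumed finite
there; `hasFiniteEntropy_sub_sub` derives this by trapping `log k` between integrable functions. -/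

lemma measurable_density : Measurable (density m P X) :=
  (Measure.measurable_rnDeriv _ _).ennreal_toReal

/-- Entropy only depends on the law. -/
lemma entropy_congr_law {Ω' : Type*} [MeasurableSpace Ω'] {Q : Measure Ω'} {Y : Ω' → E}
    (h : P.map X = Q.map Y) : entropy m P X = entropy m Q Y := by
  simp only [entropy, density, h]

/-- Weighting by the density turns integration against `m` into integration against the law of `X`.
All later estimates can thus be made under `P`. -/
lemma integrable_log_density_iff [SigmaFinite m] [IsProbabilityMeasure P] (hX : Measurable X)
    (hac : P.map X ≪ m) :
    Integrable (fun x => density m P X x * Real.log (density m P X x)) m ↔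
      Integrable (fun ω => Real.log (density m P X (X ω))) P := by
  have := Measure.isProbabilityMeasure_map (μ := P) hX.aemeasurable
  have hm : Measurable fun x => Real.log (density m P X x) := measurable_density.log
  rw [← Function.comp_def (fun x => Real.log (density m P X x)) X,
    ← integrable_map_measure hm.aestronglyMeasurable hX.aemeasurable]
  exact integrable_toReal_rnDeriv_mul_iff hac

lemma entropy_eq_neg_integral_log [SigmaFinite m] [IsProbabilityMeasure P] (hX : Measurable X)
    (hac : P.map X ≪ m) :
    entropy m P X = - ∫ ω, Real.log (density m P X (X ω)) ∂P := by
  have := Measure.isProbabilityMeasure_map (μ := P) hX.aemeasurable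
  have hm : Measurable fun x => Real.log (density m P X x) := measurable_density.log
  rw [entropy, neg_inj,
    ← integral_map (f := fun x => Real.log (density m P X x)) hX.aemeasurable
      hm.aestronglyMeasurable]
  exact integral_toReal_rnDeriv_mul hac

lemma HasFiniteEntropy.integrable_log [SigmaFinite m] [IsProbabilityMeasure P]
    (hX : Measurable X) (h : HasFiniteEntropy m P X) :
    Integrable (fun ω => Real.log (density m P X (X ω))) P :=
  (integrable_log_density_iff hX h.absolutelyContinuous).1 h.integrable

/-- Almost surely, the density at the random point is positive and finite. -/
lemma ae_exp_log_density [SigmaFinite m] [IsProbabilityMeasure P] (hX : Measurable X)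
    (hac : P.map X ≪ m) :
    ∀ᵐ ω ∂P, ENNReal.ofReal (Real.exp (Real.log (density m P X (X ω)))) =
      (P.map X).rnDeriv m (X ω) ∧ 0 < density m P X (X ω) := by
  have := Measure.isProbabilityMeasure_map (μ := P) hX.aemeasurable
  filter_upwards [ae_of_ae_map hX.aemeasurable (Measure.rnDeriv_pos hac),
    ae_of_ae_map hX.aemeasurable (hac.ae_le (Measure.rnDeriv_lt_top (P.map X) m))] with ω h0 h1
  have h2 : 0 < density m P X (X ω) := ENNReal.toReal_pos h0.ne' h1.ne
  exact ⟨by rw [Real.exp_log h2, density, ENNReal.ofReal_toReal h1.ne], h2⟩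

/-- The density cancels its inverse wherever it is neither 0 nor `∞`; at those values the product is
0, hence only an inequality. This is the cancellation step in both exponential bounds. -/
lemma lintegral_inv_rnDeriv_mul_le {μ ν : Measure E} [SigmaFinite μ] [SigmaFinite ν] (h : μ ≪ ν)
    {g : E → ℝ≥0∞} (hg : Measurable g) :
    ∫⁻ x, (μ.rnDeriv ν x)⁻¹ * g x ∂μ ≤ ∫⁻ x, g x ∂ν := by
  have hf := Measure.measurable_rnDeriv μ ν
  rw [← lintegral_rnDeriv_mul h (f := fun x => (μ.rnDeriv ν x)⁻¹ * g x) (by fun_prop)]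
  refine lintegral_mono fun x => ?_
  rw [← mul_assoc]
  exact mul_le_of_le_one_left zero_le (ENNReal.mul_inv_le_one _)

lemma lintegral_rnDeriv_map_le_one [IsProbabilityMeasure P] :
    ∫⁻ x, (P.map X).rnDeriv m x ∂m ≤ 1 :=
  Measure.lintegral_rnDeriv_le.trans <| by
    by_cases h : AEMeasurable X P
    · simp [Measure.map_apply_of_aemeasurable h MeasurableSet.univ]
    · simp [Measure.map_of_not_aemeasurable h]

lemma integrable_exp_of_lintegral_le_one {a : Ω → ℝ} (ha : Measurable a)
    (h : ∫⁻ ω, ENNReal.ofReal (Real.exp (a ω)) ∂P ≤ 1) :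
    Integrable (fun ω => Real.exp (a ω)) P :=
  (lintegral_ofReal_ne_top_iff_integrable ha.exp.aestronglyMeasurable
    (ae_of_all _ fun _ => (Real.exp_pos _).le)).1 (h.trans_lt ENNReal.one_lt_top).ne

/-- Gibbs' inequality. -/
lemma integral_nonpos_of_lintegral_exp_le_one [IsProbabilityMeasure P] {a : Ω → ℝ}
    (ha : Measurable a) (hi : Integrable a P)
    (h : ∫⁻ ω, ENNReal.ofReal (Real.exp (a ω)) ∂P ≤ 1) : ∫ ω, a ω ∂P ≤ 0 := by
  have he := integrable_exp_of_lintegral_le_one ha h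
  have h1 : ∫ ω, Real.exp (a ω) ∂P ≤ 1 := by
    rw [integral_eq_lintegral_of_nonneg_ae (ae_of_all _ fun _ => (Real.exp_pos _).le)
      ha.exp.aestronglyMeasurable]
    exact ENNReal.toReal_le_of_le_ofReal zero_le_one (by simpa using h)
  calc ∫ ω, a ω ∂P ≤ ∫ ω, (Real.exp (a ω) - 1) ∂P :=
        integral_mono hi (he.sub (integrable_const _)) fun ω => by
          have := Real.add_one_le_exp (a ω)
          simp only
          linarith
    _ ≤ 0 := by
        rw [integral_sub he (integrable_const _)]
        simpa using h1

lemma rnDeriv_prod_ae_eq {μ ν : Measure E} {μ' ν' : Measure F} [SigmaFinite μ] [SigmaFinite ν]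
    [SigmaFinite μ'] [SigmaFinite ν'] (h : μ ≪ ν) (h' : μ' ≪ ν') :
    (μ.prod μ').rnDeriv (ν.prod ν') =ᵐ[ν.prod ν']
      fun z => μ.rnDeriv ν z.1 * μ'.rnDeriv ν' z.2 := by
  have hf := Measure.measurable_rnDeriv μ ν
  have hf' := Measure.measurable_rnDeriv μ' ν'
  refine (Measure.eq_rnDeriv (s := 0) (by fun_prop) Measure.MutuallySingular.zero_left ?_).symm
  rw [zero_add, ← prod_withDensity hf hf', Measure.withDensity_rnDeriv_eq _ _ h,
    Measure.withDensity_rnDeriv_eq _ _ h']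

/-- The entropy of a pair of independent variables is the sum of their entropies. -/
lemma entropy_prodMk_of_indepFun {n : Measure F} {Y : Ω → F} [SigmaFinite m] [SigmaFinite n]
    [IsProbabilityMeasure P] (hX : Measurable X) (hY : Measurable Y) (hXY : IndepFun X Y P)
    (h : HasFiniteEntropy m P X) (h' : HasFiniteEntropy n P Y) :
    entropy (m.prod n) P (fun ω => (X ω, Y ω)) = entropy m P X + entropy n P Y := by
  have := Measure.isProbabilityMeasure_map (μ := P) hX.aemeasurable
  have := Measure.isProbabilityMeasure_map (μ := P) hY.aemeasurable
  have hlaw := (indepFun_iff_map_prod_eq_prod_map_map hX.aemeasurable hY.aemeasurable).1 hXY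
  have hac : P.map (fun ω => (X ω, Y ω)) ≪ m.prod n :=
    hlaw ▸ h.absolutelyContinuous.prod h'.absolutelyContinuous
  rw [entropy_eq_neg_integral_log (hX.prodMk hY) hac,
    entropy_eq_neg_integral_log hX h.absolutelyContinuous,
    entropy_eq_neg_integral_log hY h'.absolutelyContinuous, ← neg_add,
    ← integral_add (h.integrable_log hX) (h'.integrable_log hY)]
  congr 1
  refine integral_congr_ae ?_
  filter_upwards [ae_of_ae_map (hX.prodMk hY).aemeasurable
      (hac.ae_le (rnDeriv_prod_ae_eq h.absolutelyContinuous h'.absolutelyContinuous)),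
    ae_exp_log_density hX h.absolutelyContinuous,
    ae_exp_log_density hY h'.absolutelyContinuous] with ω h1 h2 h3
  rw [← Real.log_mul h2.2.ne' h3.2.ne']
  simp only [density, hlaw, h1, ENNReal.toReal_mul]

/-- The entropy of a pair does not depend on the order of its components. -/
lemma entropy_prodMk_comm {n : Measure F} {Y : Ω → F} [SigmaFinite m] [SigmaFinite n]
    [IsProbabilityMeasure P] (hX : Measurable X) (hY : Measurable Y) :
    entropy (n.prod m) P (fun ω => (Y ω, X ω)) = entropy (m.prod n) P (fun ω => (X ω, Y ω)) := by
  have := Measure.isProbabilityMeasure_map (μ := P) (hX.prodMk hY).aemeasurable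
  have hlaw : P.map (fun ω => (Y ω, X ω)) = (P.map fun ω => (X ω, Y ω)).map Prod.swap := by
    rw [Measure.map_map measurable_swap (hX.prodMk hY)]
    rfl
  have hs : MeasurableEmbedding (Prod.swap : E × F → F × E) :=
    MeasurableEquiv.prodComm.measurableEmbedding
  have hmp : MeasurePreserving (Prod.swap : E × F → F × E) (m.prod n) (n.prod m) :=
    Measure.measurePreserving_swap
  have hrn := hs.rnDeriv_map (P.map fun ω => (X ω, Y ω)) (m.prod n)
  rw [Measure.prod_swap] at hrn
  simp only [entropy, density, hlaw]
  rw [← hmp.integral_comp hs, neg_inj]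
  refine integral_congr_ae ?_
  filter_upwards [hrn] with z hz
  rw [hz]

/-! ### Mutual information -/

section Pair

variable {n : Measure F} {Y : Ω → F} [SigmaFinite m] [SigmaFinite n] [IsProbabilityMeasure P]

/-- Integrating the ratio of the product density to the joint density against the joint law leaves
at most the total mass of the product density. -/
lemma lintegral_exp_log_density_pair_le_one (hX : Measurable X) (hY : Measurable Y)
    (hacX : P.map X ≪ m) (hacY : P.map Y ≪ n)
    (hac : P.map (fun ω => (X ω, Y ω)) ≪ m.prod n) :
    ∫⁻ ω, ENNReal.ofReal (Real.exp (Real.log (density m P X (X ω)) +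
      Real.log (density n P Y (Y ω)) -
      Real.log (density (m.prod n) P (fun ω => (X ω, Y ω)) (X ω, Y ω)))) ∂P ≤ 1 := by
  have hXY := hX.prodMk hY
  have := Measure.isProbabilityMeasure_map (μ := P) hXY.aemeasurable
  have hf := Measure.measurable_rnDeriv (P.map X) m
  have hg := Measure.measurable_rnDeriv (P.map Y) n
  have hk := Measure.measurable_rnDeriv (P.map fun ω => (X ω, Y ω)) (m.prod n)
  calc _ = ∫⁻ ω, ((P.map fun ω => (X ω, Y ω)).rnDeriv (m.prod n) (X ω, Y ω))⁻¹ *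
        ((P.map X).rnDeriv m (X ω) * (P.map Y).rnDeriv n (Y ω)) ∂P := by
        refine lintegral_congr_ae ?_
        filter_upwards [ae_exp_log_density hX hacX, ae_exp_log_density hY hacY,
          ae_exp_log_density hXY hac] with ω h1 h2 h3
        rw [← h1.1, ← h2.1, ← h3.1, ← ENNReal.ofReal_inv_of_pos (Real.exp_pos _),
          ← ENNReal.ofReal_mul (Real.exp_pos _).le,
          ← ENNReal.ofReal_mul (inv_nonneg.2 (Real.exp_pos _).le), Real.exp_sub, Real.exp_add,
          div_eq_inv_mul]
    _ = ∫⁻ z, ((P.map fun ω => (X ω, Y ω)).rnDeriv (m.prod n) z)⁻¹ *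
        ((P.map X).rnDeriv m z.1 * (P.map Y).rnDeriv n z.2) ∂(P.map fun ω => (X ω, Y ω)) := by
        rw [lintegral_map (by fun_prop) hXY]
    _ ≤ ∫⁻ z, (P.map X).rnDeriv m z.1 * (P.map Y).rnDeriv n z.2 ∂(m.prod n) :=
        lintegral_inv_rnDeriv_mul_le hac (by fun_prop)
    _ = (∫⁻ x, (P.map X).rnDeriv m x ∂m) * ∫⁻ y, (P.map Y).rnDeriv n y ∂n :=
        lintegral_prod_mul hf.aemeasurable hg.aemeasurable
    _ ≤ 1 := mul_le_one' lintegral_rnDeriv_map_le_one lintegral_rnDeriv_map_le_one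

/-- Mutual information is nonnegative. -/
lemma mutualInfo_nonneg (hX : Measurable X) (hY : Measurable Y) (h : HasFiniteEntropy m P X)
    (h' : HasFiniteEntropy n P Y)
    (hXY : HasFiniteEntropy (m.prod n) P (fun ω => (X ω, Y ω))) :
    0 ≤ mutualInfo m n P X Y := by
  have hadd : Integrable (fun ω => Real.log (density m P X (X ω)) +
      Real.log (density n P Y (Y ω))) P := (h.integrable_log hX).add (h'.integrable_log hY)
  have key := integral_nonpos_of_lintegral_exp_le_one (by
      have h1 := measurable_density (m := m) (P := P) (X := X)
      have h2 := measurable_density (m := n) (P := P) (X := Y)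
      have h3 := measurable_density (m := m.prod n) (P := P) (X := fun ω => (X ω, Y ω))
      fun_prop)
    (hadd.sub (hXY.integrable_log (hX.prodMk hY)))
    (lintegral_exp_log_density_pair_le_one hX hY h.absolutelyContinuous h'.absolutelyContinuous
      hXY.absolutelyContinuous)
  rw [integral_sub' hadd (hXY.integrable_log (hX.prodMk hY)),
    integral_add (h.integrable_log hX) (h'.integrable_log hY)] at key
  rw [mutualInfo, entropy_eq_neg_integral_log hX h.absolutelyContinuous,
    entropy_eq_neg_integral_log hY h'.absolutelyContinuous,
    entropy_eq_neg_integral_log (hX.prodMk hY) hXY.absolutelyContinuous]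
  linarith

end Pair

end General

/-! ### Differences of independent variables in a group -/

section Group

variable {G : Type*} [AddCommGroup G] [MeasurableSpace G] [MeasurableSub₂ G] {m : Measure G}
  {Ω : Type*} [MeasurableSpace Ω] {P : Measure Ω} [IsProbabilityMeasure P] {X Y Z : Ω → G}

/-- The Ruzsa divergence of independent variables is computed by the variables themselves. -/
lemma ruzsaDiv_eq (hX : Measurable X) (hY : Measurable Y) (h : IndepFun X Y P) :
    ruzsaDiv m P X Y = entropy m P (fun ω => X ω - Y ω) - entropy m P X := by
  have hlaw := (indepFun_iff_map_prod_eq_prod_map_map hX.aemeasurable hY.aemeasurable).1 h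
  rw [ruzsaDiv, ← hlaw]
  congr 1
  · refine entropy_congr_law ?_
    rw [Measure.map_map (by fun_prop) (hX.prodMk hY)]
    rfl
  · refine entropy_congr_law ?_
    rw [Measure.map_map (by fun_prop) (hX.prodMk hY)]
    rfl

/-- For independent `X` and `Y - Z`, the entropy of `Y - Z` cancels from the conditional Ruzsa
divergence. -/
lemma condRuzsaDiv_sub_eq [SigmaFinite m] (hX : Measurable X) (hY : Measurable Y) (hZ : Measurable Z)
    (hind : IndepFun (fun ω => Y ω - Z ω) X P) (hfX : HasFiniteEntropy m P X)
    (hYZ : HasFiniteEntropy m P (fun ω => Y ω - Z ω)) :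
    condRuzsaDiv m P X Y (fun ω => Y ω - Z ω) =
      entropy (m.prod m) P (fun ω => (X ω - Y ω, Y ω - Z ω)) -
        entropy m P (fun ω => Y ω - Z ω) - entropy m P X := by
  rw [condRuzsaDiv, condEntropy, condEntropy,
    entropy_prodMk_comm (X := fun ω => X ω - Y ω) (Y := fun ω => Y ω - Z ω) (hX.sub hY)
      (hY.sub hZ),
    entropy_prodMk_of_indepFun (X := fun ω => Y ω - Z ω) (hY.sub hZ) hX hind hYZ hfX]
  ring

variable [MeasurableAdd₂ G] [SigmaFinite m] [m.IsAddLeftInvariant]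

lemma lintegral_prod_sub_shear {F : G × G → ℝ≥0∞} (hF : Measurable F) :
    ∫⁻ a, ∫⁻ b, F (a - b, b) ∂m ∂m = ∫⁻ z, F z ∂(m.prod m) := by
  rw [lintegral_lintegral_swap (by fun_prop), lintegral_prod_symm _ hF.aemeasurable]
  exact lintegral_congr fun b => lintegral_sub_right_eq_self (fun a => F (a, b)) b

/-- The differences `X - Y` and `Y - Z` have a joint density if `X` and `Y` have densities. -/
lemma absolutelyContinuous_map_sub_sub (hX : Measurable X) (hY : Measurable Y) (hZ : Measurable Z)
    (hXY : IndepFun X Y P) (hXYZ : IndepFun (fun ω => (X ω, Y ω)) Z P)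
    (hacX : P.map X ≪ m) (hacY : P.map Y ≪ m) :
    P.map (fun ω => (X ω - Y ω, Y ω - Z ω)) ≪ m.prod m := by
  have := Measure.isProbabilityMeasure_map (μ := P) hX.aemeasurable
  have := Measure.isProbabilityMeasure_map (μ := P) hY.aemeasurable
  have := Measure.isProbabilityMeasure_map (μ := P) hZ.aemeasurable
  refine Measure.AbsolutelyContinuous.mk fun s hs h0 => ?_
  have hlaw := (indepFun_iff_map_prod_eq_prod_map_map (hX.prodMk hY).aemeasurable
    hZ.aemeasurable).1 hXYZ
  rw [(indepFun_iff_map_prod_eq_prod_map_map hX.aemeasurable hY.aemeasurable).1 hXY] at hlaw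
  have hφ : Measurable fun w : (G × G) × G => (w.1.1 - w.1.2, w.1.2 - w.2) := by fun_prop
  have hmap : P.map (fun ω => (X ω - Y ω, Y ω - Z ω)) =
      (P.map fun ω => ((X ω, Y ω), Z ω)).map
        (fun w : (G × G) × G => (w.1.1 - w.1.2, w.1.2 - w.2)) := by
    rw [Measure.map_map hφ (by fun_prop)]
    rfl
  rw [hmap, hlaw, Measure.map_apply hφ hs, Measure.prod_apply_symm (hφ hs)]
  refine (lintegral_congr fun z => ?_).trans lintegral_zero
  -- With `Z = z` frozen, it suffices that the slice be `m.prod m`-null; two translations then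
  -- reduce it to `s`. The law of `Z` may be arbitrary.
  refine (hacX.prod hacY) ?_
  have hpre : MeasurableSet {w : G × G | (w.1 - w.2, w.2 - z) ∈ s} :=
    (show Measurable fun w : G × G => (w.1 - w.2, w.2 - z) by fun_prop) hs
  change (m.prod m) {w : G × G | (w.1 - w.2, w.2 - z) ∈ s} = 0
  rw [Measure.prod_apply_symm hpre]
  have hF : Measurable (s.indicator (1 : G × G → ℝ≥0∞)) := measurable_one.indicator hs
  calc ∫⁻ y, m {x | (x - y, y - z) ∈ s} ∂m
      = ∫⁻ y, m {x | (x, y - z) ∈ s} ∂m := lintegral_congr fun y => by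
        simpa [sub_eq_add_neg] using
          measure_preimage_add_right m (-y) {x | (x, y - z) ∈ s}
    _ = ∫⁻ y, m {x | (x, y) ∈ s} ∂m :=
        lintegral_sub_right_eq_self (fun y => m {x | (x, y) ∈ s}) z
    _ = 0 := by rw [← h0, Measure.prod_apply_symm hs]; rfl

/-- The core estimate. Two cancellations, first against the law of `Y` and then against that of `X -
Z`, reduce the expectation to the mass of the joint density. -/
lemma lintegral_exp_log_density_sub_sub_le_one (hX : Measurable X) (hY : Measurable Y)
    (hZ : Measurable Z) (hind : IndepFun (fun ω => (X ω, Z ω)) Y P)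
    (hacXZ : P.map (fun ω => X ω - Z ω) ≪ m) (hacY : P.map Y ≪ m)
    (hac : P.map (fun ω => (X ω - Y ω, Y ω - Z ω)) ≪ m.prod m) :
    ∫⁻ ω, ENNReal.ofReal (Real.exp (
      Real.log (density (m.prod m) P (fun ω => (X ω - Y ω, Y ω - Z ω)) (X ω - Y ω, Y ω - Z ω)) -
      (Real.log (density m P (fun ω => X ω - Z ω) (X ω - Z ω)) +
        Real.log (density m P Y (Y ω))))) ∂P ≤ 1 := by
  have hU : Measurable fun ω => (X ω - Y ω, Y ω - Z ω) := by fun_prop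
  have hA : Measurable fun ω => X ω - Z ω := by fun_prop
  have := Measure.isProbabilityMeasure_map (μ := P) (hX.prodMk hZ).aemeasurable
  have := Measure.isProbabilityMeasure_map (μ := P) hY.aemeasurable
  have := Measure.isProbabilityMeasure_map (μ := P) hA.aemeasurable
  set k := (P.map fun ω => (X ω - Y ω, Y ω - Z ω)).rnDeriv (m.prod m) with hk_def
  set f := (P.map fun ω => X ω - Z ω).rnDeriv m with hf_def
  set g := (P.map Y).rnDeriv m with hg_def
  have hk : Measurable k := Measure.measurable_rnDeriv _ _
  have hf : Measurable f := Measure.measurable_rnDeriv _ _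
  have hg : Measurable g := Measure.measurable_rnDeriv _ _
  have hlaw := (indepFun_iff_map_prod_eq_prod_map_map (hX.prodMk hZ).aemeasurable
    hY.aemeasurable).1 hind
  have hK : Measurable fun a => ∫⁻ b, k (a - b, b) ∂m :=
    Measurable.lintegral_prod_right' (f := fun w : G × G => k (w.1 - w.2, w.2)) (by fun_prop)
  calc _ = ∫⁻ ω, (g (Y ω))⁻¹ * ((f (X ω - Z ω))⁻¹ * k (X ω - Y ω, Y ω - Z ω)) ∂P := by
        refine lintegral_congr_ae ?_
        filter_upwards [ae_exp_log_density hU hac, ae_exp_log_density hA hacXZ,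
          ae_exp_log_density hY hacY] with ω h1 h2 h3
        rw [hk_def, hf_def, hg_def, ← h1.1, ← h2.1, ← h3.1,
          ← ENNReal.ofReal_inv_of_pos (Real.exp_pos _),
          ← ENNReal.ofReal_inv_of_pos (Real.exp_pos _),
          ← ENNReal.ofReal_mul (inv_nonneg.2 (Real.exp_pos _).le),
          ← ENNReal.ofReal_mul (inv_nonneg.2 (Real.exp_pos _).le), Real.exp_sub, Real.exp_add,
          div_eq_inv_mul, mul_inv_rev, mul_assoc]
    _ = ∫⁻ w, (g w.2)⁻¹ * ((f (w.1.1 - w.1.2))⁻¹ * k (w.1.1 - w.2, w.2 - w.1.2))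
          ∂(P.map fun ω => ((X ω, Z ω), Y ω)) := by
        rw [lintegral_map (by fun_prop) (by fun_prop)]
    _ = ∫⁻ w, ∫⁻ y, (g y)⁻¹ * ((f (w.1 - w.2))⁻¹ * k (w.1 - y, y - w.2)) ∂(P.map Y)
          ∂(P.map fun ω => (X ω, Z ω)) := by
        rw [hlaw, lintegral_prod _ (by fun_prop)]
    _ ≤ ∫⁻ w, (f (w.1 - w.2))⁻¹ * ∫⁻ b, k (w.1 - w.2 - b, b) ∂m
          ∂(P.map fun ω => (X ω, Z ω)) := by
        refine lintegral_mono fun w => ?_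
        refine (lintegral_inv_rnDeriv_mul_le hacY (by fun_prop)).trans_eq ?_
        rw [lintegral_const_mul _ (by fun_prop),
          -- Substituting `b = y - z` makes the inner integral depend on `x - z` only.
          ← lintegral_sub_right_eq_self (fun b => k (w.1 - w.2 - b, b)) w.2]
        simp
    _ = ∫⁻ a, (f a)⁻¹ * ∫⁻ b, k (a - b, b) ∂m ∂(P.map fun ω => X ω - Z ω) := by
        have hfK : Measurable fun a => (f a)⁻¹ * ∫⁻ b, k (a - b, b) ∂m := hf.inv.mul hK
        rw [lintegral_map hfK hA, lintegral_map ?_ (hX.prodMk hZ)]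
        exact hfK.comp (measurable_fst.sub measurable_snd)
    _ ≤ ∫⁻ a, ∫⁻ b, k (a - b, b) ∂m ∂m := lintegral_inv_rnDeriv_mul_le hacXZ hK
    _ = ∫⁻ z, k z ∂(m.prod m) := lintegral_prod_sub_shear hk
    _ ≤ 1 := lintegral_rnDeriv_map_le_one

/-- Submodularity: `h(X - Z) + h(Y) ≤ h(X - Y, Y - Z)`. -/
lemma entropy_sub_add_entropy_le (hX : Measurable X) (hY : Measurable Y)
    (hZ : Measurable Z) (hind : IndepFun (fun ω => (X ω, Z ω)) Y P)
    (hXZ : HasFiniteEntropy m P (fun ω => X ω - Z ω)) (hfY : HasFiniteEntropy m P Y)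
    (h : HasFiniteEntropy (m.prod m) P (fun ω => (X ω - Y ω, Y ω - Z ω))) :
    entropy m P (fun ω => X ω - Z ω) + entropy m P Y ≤
      entropy (m.prod m) P (fun ω => (X ω - Y ω, Y ω - Z ω)) := by
  have hU : Measurable fun ω => (X ω - Y ω, Y ω - Z ω) := by fun_prop
  have hA : Measurable fun ω => X ω - Z ω := by fun_prop
  have hadd : Integrable (fun ω => Real.log (density m P (fun ω => X ω - Z ω) (X ω - Z ω)) +
      Real.log (density m P Y (Y ω))) P := (hXZ.integrable_log hA).add (hfY.integrable_log hY)
  have key := integral_nonpos_of_lintegral_exp_le_one (by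
      have h1 := measurable_density (m := m) (P := P) (X := fun ω => X ω - Z ω)
      have h2 := measurable_density (m := m) (P := P) (X := Y)
      have h3 := measurable_density (m := m.prod m) (P := P)
        (X := fun ω => (X ω - Y ω, Y ω - Z ω))
      fun_prop)
    ((h.integrable_log hU).sub hadd)
    (lintegral_exp_log_density_sub_sub_le_one hX hY hZ hind hXZ.absolutelyContinuous
      hfY.absolutelyContinuous h.absolutelyContinuous)
  rw [integral_sub' (h.integrable_log hU) hadd,
    integral_add (hXZ.integrable_log hA) (hfY.integrable_log hY)] at key
  rw [entropy_eq_neg_integral_log hU h.absolutelyContinuous,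
    entropy_eq_neg_integral_log hA hXZ.absolutelyContinuous,
    entropy_eq_neg_integral_log hY hfY.absolutelyContinuous]
  linarith

/-- The joint entropy of `X - Y` and `Y - Z` is finite as soon as those of `X - Y`, `Y - Z`,
`X - Z` and `Y` are. -/
lemma hasFiniteEntropy_sub_sub (hX : Measurable X) (hY : Measurable Y)
    (hZ : Measurable Z) (hind : IndepFun (fun ω => (X ω, Z ω)) Y P)
    (hac : P.map (fun ω => (X ω - Y ω, Y ω - Z ω)) ≪ m.prod m)
    (hXZ : HasFiniteEntropy m P (fun ω => X ω - Z ω)) (hfY : HasFiniteEntropy m P Y)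
    (hXY : HasFiniteEntropy m P (fun ω => X ω - Y ω))
    (hYZ : HasFiniteEntropy m P (fun ω => Y ω - Z ω)) :
    HasFiniteEntropy (m.prod m) P (fun ω => (X ω - Y ω, Y ω - Z ω)) := by
  have hU : Measurable fun ω => (X ω - Y ω, Y ω - Z ω) := by fun_prop
  have hA : Measurable fun ω => X ω - Z ω := by fun_prop
  have hB : Measurable fun ω => X ω - Y ω := by fun_prop
  have hC : Measurable fun ω => Y ω - Z ω := by fun_prop
  have h1 := measurable_density (m := m) (P := P) (X := fun ω => X ω - Z ω)
  have h2 := measurable_density (m := m) (P := P) (X := Y)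
  have h3 := measurable_density (m := m.prod m) (P := P) (X := fun ω => (X ω - Y ω, Y ω - Z ω))
  have h4 := measurable_density (m := m) (P := P) (X := fun ω => X ω - Y ω)
  have h5 := measurable_density (m := m) (P := P) (X := fun ω => Y ω - Z ω)
  have hupper := integrable_exp_of_lintegral_le_one (by fun_prop)
    (lintegral_exp_log_density_sub_sub_le_one hX hY hZ hind hXZ.absolutelyContinuous
      hfY.absolutelyContinuous hac)
  have hlower := integrable_exp_of_lintegral_le_one (by fun_prop)
    (lintegral_exp_log_density_pair_le_one hB hC hXY.absolutelyContinuous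
      hYZ.absolutelyContinuous hac)
  refine ⟨hac, (integrable_log_density_iff hU hac).2 ?_⟩
  -- The two bounds come from `t ≤ exp t`, applied to the exponents of the mutual information bound
  -- (below) and of the submodularity bound (above); both exponentials are integrable.
  refine integrable_of_le_of_le (h3.comp hU).log.aestronglyMeasurable (ae_of_all _ fun ω => ?_) (ae_of_all _ fun ω => ?_)
    (((hXY.integrable_log hB).add (hYZ.integrable_log hC)).sub hlower)
    (((hXZ.integrable_log hA).add (hfY.integrable_log hY)).add hupper)
  · simp only [Pi.sub_apply, Pi.add_apply]
    have := Real.add_one_le_exp (Real.log (density m P (fun ω => X ω - Y ω) (X ω - Y ω)) +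
      Real.log (density m P (fun ω => Y ω - Z ω) (Y ω - Z ω)) -
      Real.log (density (m.prod m) P (fun ω => (X ω - Y ω, Y ω - Z ω)) (X ω - Y ω, Y ω - Z ω)))
    linarith
  · simp only [Pi.add_apply]
    have := Real.add_one_le_exp (
      Real.log (density (m.prod m) P (fun ω => (X ω - Y ω, Y ω - Z ω)) (X ω - Y ω, Y ω - Z ω)) -
      (Real.log (density m P (fun ω => X ω - Z ω) (X ω - Z ω)) +
        Real.log (density m P Y (Y ω))))
    linarith

end Group

end Ruzsa

theorem theorem3p4 {G : Type*} [AddCommGroup G] [TopologicalSpace G] [IsTopologicalAddGroup G]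
    [PolishSpace G] [LocallyCompactSpace G] [MeasurableSpace G] [BorelSpace G]
    (m : Measure G) [m.IsAddHaarMeasure]
    {Ω : Type*} [MeasurableSpace Ω] (P : Measure Ω) [IsProbabilityMeasure P]
    (X₁ X₂ X₃ : Ω → G)
    (hX₁ : Measurable X₁) (hX₂ : Measurable X₂) (hX₃ : Measurable X₃)
    (hindep : iIndepFun ![X₁, X₂, X₃] P)
    (h₁ : Ruzsa.HasFiniteEntropy m P X₁)
    (h₂ : Ruzsa.HasFiniteEntropy m P X₂)
    (h₃ : Ruzsa.HasFiniteEntropy m P X₃)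
    (h₁₃ : Ruzsa.HasFiniteEntropy m P (fun ω => X₁ ω - X₃ ω))
    (h₂₃ : Ruzsa.HasFiniteEntropy m P (fun ω => X₂ ω - X₃ ω)) :
    -- the sharpened triangle inequality
    (Ruzsa.HasFiniteEntropy (m.prod m) P (fun ω => (X₁ ω - X₂ ω, X₂ ω - X₃ ω)) →
      Ruzsa.ruzsaDiv m P X₁ X₃ ≤
        Ruzsa.condRuzsaDiv m P X₁ X₂ (fun ω => X₂ ω - X₃ ω) + Ruzsa.ruzsaDiv m P X₂ X₃) ∧
    -- its symmetric form, with the equality of the two right-hand sides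
    (Ruzsa.HasFiniteEntropy m P (fun ω => X₁ ω - X₂ ω) →
      Ruzsa.HasFiniteEntropy (m.prod m) P (fun ω => (X₁ ω - X₂ ω, X₂ ω - X₃ ω)) →
      Ruzsa.condRuzsaDiv m P X₁ X₂ (fun ω => X₂ ω - X₃ ω) + Ruzsa.ruzsaDiv m P X₂ X₃ =
        Ruzsa.ruzsaDiv m P X₁ X₂ + Ruzsa.ruzsaDiv m P X₂ X₃ -
          Ruzsa.mutualInfo m m P (fun ω => X₁ ω - X₂ ω) (fun ω => X₂ ω - X₃ ω) ∧
      Ruzsa.ruzsaDiv m P X₁ X₃ ≤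
        Ruzsa.ruzsaDiv m P X₁ X₂ + Ruzsa.ruzsaDiv m P X₂ X₃ -
          Ruzsa.mutualInfo m m P (fun ω => X₁ ω - X₂ ω) (fun ω => X₂ ω - X₃ ω)) ∧
    -- the triangle inequality
    (Ruzsa.HasFiniteEntropy m P (fun ω => X₁ ω - X₂ ω) →
      Ruzsa.ruzsaDiv m P X₁ X₃ ≤ Ruzsa.ruzsaDiv m P X₁ X₂ + Ruzsa.ruzsaDiv m P X₂ X₃) := by
  have hmeas : ∀ i, Measurable (![X₁, X₂, X₃] i) := by
    intro i
    fin_cases i <;> assumption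
  have i₁₂ : IndepFun X₁ X₂ P := hindep.indepFun (i := 0) (j := 1) (by decide)
  have i₁₃ : IndepFun X₁ X₃ P := hindep.indepFun (i := 0) (j := 2) (by decide)
  have i₂₃ : IndepFun X₂ X₃ P := hindep.indepFun (i := 1) (j := 2) (by decide)
  have i₁₂_₃ : IndepFun (fun ω => (X₁ ω, X₂ ω)) X₃ P :=
    hindep.indepFun_prodMk hmeas 0 1 2 (by decide) (by decide)
  have i₁₃_₂ : IndepFun (fun ω => (X₁ ω, X₃ ω)) X₂ P :=
    hindep.indepFun_prodMk hmeas 0 2 1 (by decide) (by decide)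
  have i₂₃_₁ : IndepFun (fun ω => X₂ ω - X₃ ω) X₁ P :=
    (hindep.indepFun_prodMk hmeas 1 2 0 (by decide) (by decide)).comp
      (φ := fun z : G × G => z.1 - z.2) (by fun_prop) measurable_id
  have hcond := Ruzsa.condRuzsaDiv_sub_eq (m := m) hX₁ hX₂ hX₃ i₂₃_₁ h₁ h₂₃
  rw [hcond, Ruzsa.ruzsaDiv_eq hX₁ hX₃ i₁₃, Ruzsa.ruzsaDiv_eq hX₁ hX₂ i₁₂,
    Ruzsa.ruzsaDiv_eq hX₂ hX₃ i₂₃]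
  refine ⟨fun h => ?_, fun h₁₂ h => ⟨?_, ?_⟩, fun h₁₂ => ?_⟩
  · linarith [Ruzsa.entropy_sub_add_entropy_le hX₁ hX₂ hX₃ i₁₃_₂ h₁₃ h₂ h]
  · rw [Ruzsa.mutualInfo]
    ring
  · rw [Ruzsa.mutualInfo]
    linarith [Ruzsa.entropy_sub_add_entropy_le hX₁ hX₂ hX₃ i₁₃_₂ h₁₃ h₂ h]
  · have h := Ruzsa.hasFiniteEntropy_sub_sub hX₁ hX₂ hX₃ i₁₃_₂
      (Ruzsa.absolutelyContinuous_map_sub_sub hX₁ hX₂ hX₃ i₁₂ i₁₂_₃ h₁.absolutelyContinuous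
        h₂.absolutelyContinuous) h₁₃ h₂ h₁₂ h₂₃
    have hI := Ruzsa.mutualInfo_nonneg (hX₁.sub hX₂) (hX₂.sub hX₃) h₁₂ h₂₃ h
    rw [Ruzsa.mutualInfo] at hI
    simp only [Pi.sub_def] at hI
    linarith [Ruzsa.entropy_sub_add_entropy_le hX₁ hX₂ hX₃ i₁₃_₂ h₁₃ h₂ h]
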